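/- Let $\mathcal{B}$ be a bicategory, let $\mathrm{Cat}$ be the bicategory of categories, functors and natural transformations (of a size such that every hom-category $\mathcal{B}(b,a)$ is an object of $\mathrm{Cat}$), let $\mathcal{B}^{\mathrm{op}}$ be the bicategory obtained from $\mathcal{B}$ by reversing the 1-cells only, and let $\mathrm{Pseudo}(\mathcal{B}^{\mathrm{op}},\mathrm{Cat})$ be the bicategory of pseudofunctors, pseudotransformations and modifications. Let $y:\mathcal{B}\to\mathrm{Pseudo}(\mathcal{B}^{\mathrm{op}},\mathrm{Cat})$ be the Yoneda embedding: $y(a)$ is the representable pseudofunctor $b\mapsto\mathcal{B}(b,a)$, acting on 1-cells and 2-cells by precomposition, and $y$ acts on 1-cells and 2-cells of $\mathcal{B}$ by postcomposition. (1) (Bicategorical Yoneda lemma.) For every pseudofunctor $P:\mathcal{B}^{\mathrm{op}}\to\mathrm{Cat}$ and every object $a$ of $\mathcal{B}$ there is an adjoint equivalence of categories $$\mathrm{Pseudo}(\mathcal{B}^{\mathrm{op}},\mathrm{Cat})(y(a),P)\;\simeq\;P(a),$$ given by functors $F$ from left to right and $G$ from right to left as follows. The functor $F$ sends a pseudotransformation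 $\tau$ to $\tau(a)(\mathrm{id}_a)$ and a modification $m$ to the component of the natural transformation $m(a)$ at $\mathrm{id}_a$. The functor $G$ sends an object $z$ of $P(a)$ to a pseudotransformation $y(a)\to P$ whose component at an object $b$ is the functor $\mathcal{B}(b,a)\to P(b)$ that sends a 1-cell $f:b\to a$ to $P(f)(z)$ and a 2-cell $\theta$ to the component of $P(\theta)$ at $z$. (2) The pseudofunctor $y$ is a local equivalence: for all objects $x,x'$ of $\mathcal{B}$ the functor $\mathcal{B}(x,x')\to\mathrm{Pseudo}(\mathcal{B}^{\mathrm{op}},\mathrm{Cat})(y(x),y(x'))$ induced by $y$ is an adjoint equivalence of categories. -/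

import Mathlib

open CategoryTheory Bicategory Opposite

-- The bicategory of pseudofunctors, pseudotransformations and modifications is a scoped instance.
open scoped CategoryTheory.Pseudofunctor.StrongTrans

universe w v u w₁ v₁ u₁ w₂ v₂ u₂

namespace BicatYoneda

/-- A pseudofunctor `F` is a local equivalence if each functor `B(x, y) ⥤ C(F x, F y)` induced by
`F` on hom-categories is (the functor part of) an adjoint equivalence of categories. -/
def IsLocalEquivalence {B : Type u₁} [Bicategory.{w₁, v₁} B] {C : Type u₂} [Bicategory.{w₂, v₂} C]
    (F : B ⥤ᵖ C) : Prop :=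
  ∀ x y : B, ∃ e : (x ⟶ y) ≌ (F.obj x ⟶ F.obj y), e.functor = F.mapFunctor x y

variable {B : Type u} [Bicategory.{w, v} B]

/-- Evaluation at the identity 1-cell: the functor from the hom-category `Pseudo(Bᵒᵖ, Cat)(y(a), P)`
to `P(a)` that sends a pseudotransformation `τ` to `τ(a)(id_a)` and a modification `m` to the
component of `m(a)` at `id_a`. -/
def evalAtId (P : Bᵒᵖ ⥤ᵖ Cat.{w, v}) (a : B) :
    (Bicategory.yoneda.obj a ⟶ P) ⥤ P.obj (op a) where
  obj τ := (τ.app (op a)).toFunctor.obj (𝟙 a : a ⟶ a)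
  map m := (m.as.app (op a)).toNatTrans.app (𝟙 a : a ⟶ a)
  map_id _ := rfl
  map_comp _ _ := rfl

/-- For an object `z` of `P(a)` and an object `b`, the functor `B(b, a) ⥤ P(b)` that sends a 1-cell
`f : b ⟶ a` to `P(f)(z)` and a 2-cell `θ` to the component of `P(θ)` at `z`. -/
def actOn (P : Bᵒᵖ ⥤ᵖ Cat.{w, v}) {a : B} (z : P.obj (op a)) (b : B) :
    (b ⟶ a) ⥤ P.obj (op b) where
  obj f := (P.map f.op).toFunctor.obj z
  map θ := (P.map₂ (Bicategory.Opposite.op2 θ)).toNatTrans.app z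
  map_id f := by
    rw [Bicategory.Opposite.op2_id, P.map₂_id]
    rfl
  map_comp θ θ' := by
    rw [Bicategory.Opposite.op2_comp, P.map₂_comp]
    rfl

end BicatYoneda

namespace BicatYoneda

variable {B : Type u} [Bicategory.{w, v} B] (P : Bᵒᵖ ⥤ᵖ Cat.{w, v}) {a : B}

/-! A pseudotransformation `τ : y(a) ⟶ P` is determined up to isomorphism by `τ(a)(id_a)`: the right
unitor and pseudonaturality give `τ(f) ≅ τ(f ≫ 𝟙) ≅ P(f)(τ(𝟙))`. These isomorphisms
(`unitComponent`) form the unit; the counit `P(𝟙)(z) ≅ z` is the unit constraint of `P`. Coherence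
of `P` makes `P(-)(z)` a pseudotransformation. For the local equivalence, evaluation at the identity
after `y` sends `f` to `𝟙 ≫ f ≅ f`, so two-out-of-three applies. -/

/-- The structure 2-cell of `ofElement` at a 1-cell `g`. -/
def actOnNaturality (z : P.obj (op a)) {b c : Bᵒᵖ} (g : b ⟶ c) :
    (Bicategory.yoneda.obj a).map g ≫ (actOn P z c.unop).toCatHom ≅
      (actOn P z b.unop).toCatHom ≫ P.map g :=
  Cat.Hom.isoMk (F := ((precomp a g.unop) ⋙ actOn P z c.unop))
    (G := actOn P z b.unop ⋙ (P.map g).toFunctor) <|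
  NatIso.ofComponents (fun f => (Cat.Hom.toNatIso (P.mapComp f.op g)).app z) (by
    intro f f' θ
    have h : P.map₂ (Bicategory.Opposite.op2 θ ▷ g) ≫ (P.mapComp f'.op g).hom =
        (P.mapComp f.op g).hom ≫ P.map₂ (Bicategory.Opposite.op2 θ) ▷ P.map g := by
      simp
    exact congr($(h).toNatTrans.app z))

/-- The pseudotransformation `y(a) ⟶ P` determined by an object `z` of `P(a)`. -/
def ofElement (z : P.obj (op a)) : Bicategory.yoneda.obj a ⟶ P where
  app b := (actOn P z b.unop).toCatHom
  naturality g := actOnNaturality P z g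
  naturality_naturality {b c f g} η := by
    ext h
    have e : P.map₂ (h.op ◁ η) ≫ (P.mapComp h.op g).hom =
        (P.mapComp h.op f).hom ≫ P.map h.op ◁ P.map₂ η := by simp
    exact congr($(e).toNatTrans.app z)
  naturality_id b := by
    ext h
    have e : (P.mapComp h.op (𝟙 b)).hom ≫ P.map h.op ◁ (P.mapId b).hom =
        P.map₂ (ρ_ h.op).hom ≫ (ρ_ (P.map h.op)).inv := by simp
    refine congr($(e).toNatTrans.app z).trans ?_
    exact congrArg _ (Category.id_comp _).symm
  naturality_comp {b c d} f g := by
    ext h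
    have e := P.mapComp_assoc_right_hom h.op f g
    refine congr($(e).toNatTrans.app z).trans ?_
    refine congrArg _ ?_
    -- The identities are components of associators, which are trivial in `Cat`.
    change _ ≫ _ ≫ 𝟙 _ = 𝟙 _ ≫ _ ≫ 𝟙 _ ≫ _ ≫ 𝟙 _
    rw [Category.id_comp, Category.id_comp]
    rfl

section Transformation

variable {P} (τ : Bicategory.yoneda.obj a ⟶ P)

/-- The component of a pseudotransformation `y(a) ⟶ P` at `b`, as a functor on `b ⟶ a`. -/
abbrev component (b : B) : (b ⟶ a) ⥤ P.obj (op b) :=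
  (τ.app (op b)).toFunctor

/-- The structure isomorphism of a pseudotransformation `τ : y(a) ⟶ P` at a 1-cell `g`, evaluated
at a 1-cell `f`. -/
def structureIso {b c : B} (g : c ⟶ b) (f : b ⟶ a) :
    (component τ c).obj (g ≫ f) ≅ (P.map g.op).toFunctor.obj ((component τ b).obj f) :=
  (Cat.Hom.toNatIso (τ.naturality g.op)).app f

lemma structureIso_hom_naturality_right {b c : B} (g : c ⟶ b) {f f' : b ⟶ a} (θ : f ⟶ f') :
    (component τ c).map (g ◁ θ) ≫ (structureIso τ g f').hom =
      (structureIso τ g f).hom ≫ (P.map g.op).toFunctor.map ((component τ b).map θ) :=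
  (τ.naturality g.op).hom.toNatTrans.naturality θ

lemma structureIso_hom_naturality_left {b c : B} {g g' : c ⟶ b} (θ : g ⟶ g') (f : b ⟶ a) :
    (component τ c).map (θ ▷ f) ≫ (structureIso τ g' f).hom =
      (structureIso τ g f).hom ≫
        (P.map₂ (Bicategory.Opposite.op2 θ)).toNatTrans.app ((component τ b).obj f) :=
  congr($(τ.naturality_naturality (Bicategory.Opposite.op2 θ)).toNatTrans.app f)

lemma structureIso_hom_comp {b c d : B} (h : d ⟶ c) (g : c ⟶ b) (f : b ⟶ a) :
    (structureIso τ (h ≫ g) f).hom ≫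
        (P.mapComp g.op h.op).hom.toNatTrans.app ((component τ b).obj f) =
      (component τ d).map (α_ h g f).hom ≫ (structureIso τ h (g ≫ f)).hom ≫
        (P.map h.op).toFunctor.map (structureIso τ g f).hom := by
  have e : (structureIso τ (h ≫ g) f).hom ≫
        (P.mapComp g.op h.op).hom.toNatTrans.app ((component τ b).obj f) =
      (component τ d).map (α_ h g f).hom ≫ 𝟙 _ ≫ (structureIso τ h (g ≫ f)).hom ≫ 𝟙 _ ≫
        (P.map h.op).toFunctor.map (structureIso τ g f).hom ≫ 𝟙 _ :=
    congr($(τ.naturality_comp g.op h.op).toNatTrans.app f)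
  simpa only [Category.id_comp, Category.comp_id] using e

lemma modification_naturality {τ σ : Bicategory.yoneda.obj a ⟶ P} (m : τ ⟶ σ) {b c : B}
    (g : c ⟶ b) (f : b ⟶ a) :
    (m.as.app (op c)).toNatTrans.app (g ≫ f : c ⟶ a) ≫ (structureIso σ g f).hom =
      (structureIso τ g f).hom ≫ (P.map g.op).toFunctor.map ((m.as.app (op b)).toNatTrans.app f) :=
  congr($(m.as.naturality g.op).toNatTrans.app f)

/-- The component at `f : b ⟶ a` of the unit of the Yoneda equivalence at `τ`. -/
def unitComponent {b : B} (f : b ⟶ a) :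
    (component τ b).obj f ≅ (P.map f.op).toFunctor.obj ((component τ a).obj (𝟙 a)) :=
  (component τ b).mapIso (ρ_ f).symm ≪≫ structureIso τ f (𝟙 a)

lemma unitComponent_hom {b : B} (f : b ⟶ a) :
    (unitComponent τ f).hom = (component τ b).map (ρ_ f).inv ≫ (structureIso τ f (𝟙 a)).hom :=
  rfl

lemma unitComponent_hom_naturality {b : B} {f g : b ⟶ a} (θ : f ⟶ g) :
    (component τ b).map θ ≫ (unitComponent τ g).hom =
      (unitComponent τ f).hom ≫
        (P.map₂ (Bicategory.Opposite.op2 θ)).toNatTrans.app ((component τ a).obj (𝟙 a)) := by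
  rw [unitComponent_hom, unitComponent_hom, Category.assoc, ← structureIso_hom_naturality_left,
    ← Functor.map_comp_assoc, ← Functor.map_comp_assoc, rightUnitor_inv_naturality]

/-- The modification axiom for the unit. It is `structureIso_hom_comp` at the triple `g`, `f`, `𝟙
a`, whose associator is absorbed by coherence of the right unitor. -/
lemma unitComponent_hom_comp {b c : B} (g : c ⟶ b) (f : b ⟶ a) :
    (unitComponent τ (g ≫ f)).hom ≫
        (P.mapComp f.op g.op).hom.toNatTrans.app ((component τ a).obj (𝟙 a)) =
      (structureIso τ g f).hom ≫ (P.map g.op).toFunctor.map (unitComponent τ f).hom := by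
  rw [unitComponent_hom, unitComponent_hom, Category.assoc, structureIso_hom_comp,
    Functor.map_comp, ← Category.assoc (structureIso τ g f).hom,
    ← structureIso_hom_naturality_right, ← Functor.map_comp_assoc, Category.assoc,
    rightUnitor_comp_inv, Category.assoc, Iso.inv_hom_id, Category.comp_id]

/-- Naturality of the unit in `τ`: the modification axiom of `m` at `𝟙 a`, transported along the
right unitor. -/
lemma unitComponent_hom_modification {τ σ : Bicategory.yoneda.obj a ⟶ P} (m : τ ⟶ σ) {b : B}
    (f : b ⟶ a) :
    (m.as.app (op b)).toNatTrans.app f ≫ (unitComponent σ f).hom =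
      (unitComponent τ f).hom ≫
        (P.map f.op).toFunctor.map ((m.as.app (op a)).toNatTrans.app (𝟙 a : a ⟶ a)) := by
  have n : (component τ b).map (ρ_ f).inv ≫
        (m.as.app (op b)).toNatTrans.app (f ≫ 𝟙 a : b ⟶ a) =
      (m.as.app (op b)).toNatTrans.app f ≫ (component σ b).map (ρ_ f).inv :=
    (m.as.app (op b)).toNatTrans.naturality (ρ_ f).inv
  rw [unitComponent_hom, unitComponent_hom, Category.assoc, ← modification_naturality]
  exact (Category.assoc _ _ _).symm.trans ((congrArg (· ≫ _) n.symm).trans (Category.assoc _ _ _))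

end Transformation

/-- The functor that sends an object `z` of `P(a)` to the pseudotransformation `ofElement P z`. -/
def ofElementFunctor (a : B) : P.obj (op a) ⥤ (Bicategory.yoneda.obj a ⟶ P) where
  obj z := ofElement P z
  map k :=
    { as :=
      { app b := NatTrans.toCatHom₂ (F := actOn P _ b.unop) (G := actOn P _ b.unop)
          { app f := (P.map f.op).toFunctor.map k
            naturality f f' θ := ((P.map₂ (Bicategory.Opposite.op2 θ)).toNatTrans.naturality k).symm }
        naturality {b c} g := by
          ext h
          exact ((P.mapComp h.op g).hom.toNatTrans.naturality k) } }
  map_id z := by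
    ext b f
    exact (P.map f.op).toFunctor.map_id z
  map_comp k l := by
    ext b f
    exact (P.map f.op).toFunctor.map_comp k l

/-- The unit of the Yoneda equivalence. -/
def unitIso (a : B) : 𝟭 (Bicategory.yoneda.obj a ⟶ P) ≅ evalAtId P a ⋙ ofElementFunctor P a :=
  NatIso.ofComponents (fun τ => Pseudofunctor.StrongTrans.isoMk
    (fun b => Cat.Hom.isoMk (F := (τ.app b).toFunctor) (G := actOn P _ b.unop)
      (NatIso.ofComponents (fun f => unitComponent τ f) (fun θ => unitComponent_hom_naturality τ θ)))
    (by
      intro b c g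
      ext f
      exact unitComponent_hom_comp τ g.unop f))
    (by
      intro τ σ m
      ext b f
      exact unitComponent_hom_modification m f)

/-- The counit of the Yoneda equivalence: `P(id_a)(z) ≅ z`. -/
def counitIso (a : B) : ofElementFunctor P a ⋙ evalAtId P a ≅ 𝟭 (P.obj (op a)) :=
  NatIso.ofComponents (fun z => (Cat.Hom.toNatIso (P.mapId (op a))).app z)
    (fun k => (P.mapId (op a)).hom.toNatTrans.naturality k)

/-- The bicategorical Yoneda lemma: evaluation at the identity is an equivalence, with inverse
`ofElementFunctor P a`. -/
def yonedaEquivalence (a : B) : (Bicategory.yoneda.obj a ⟶ P) ≌ P.obj (op a) :=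
  -- `Equivalence.mk` corrects the unit so that the triangle identities hold; both functors are
  -- kept.
  CategoryTheory.Equivalence.mk (evalAtId P a) (ofElementFunctor P a) (unitIso P a) (counitIso P a)

/-- Evaluation at the identity retracts the functor induced by `yoneda` on hom-categories. -/
def mapFunctorCompEvalAtId (x y : B) :
    Bicategory.yoneda.mapFunctor x y ⋙ evalAtId (Bicategory.yoneda.obj y) x ≅ 𝟭 (x ⟶ y) :=
  NatIso.ofComponents (fun f => λ_ f) (fun θ => leftUnitor_naturality θ)

lemma isLocalEquivalence_yoneda : IsLocalEquivalence (Bicategory.yoneda (B := B)) := by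
  intro x y
  have : (evalAtId (Bicategory.yoneda.obj y) x).IsEquivalence :=
    (yonedaEquivalence (Bicategory.yoneda.obj y) x).isEquivalence_functor
  have : (Bicategory.yoneda.mapFunctor x y ⋙ evalAtId (Bicategory.yoneda.obj y) x).IsEquivalence :=
    have := (CategoryTheory.Equivalence.refl (C := (x ⟶ y))).isEquivalence_functor
    Functor.isEquivalence_of_iso (F := 𝟭 (x ⟶ y)) (mapFunctorCompEvalAtId x y).symm
  have : (Bicategory.yoneda.mapFunctor x y).IsEquivalence :=
    Functor.isEquivalence_of_comp_right _ (evalAtId (Bicategory.yoneda.obj y) x)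
  exact ⟨(Bicategory.yoneda.mapFunctor x y).asEquivalence, rfl⟩

end BicatYoneda

theorem mainTheorem4 {B : Type u} [Bicategory.{w, v} B] :
    (∀ (P : Bᵒᵖ ⥤ᵖ Cat.{w, v}) (a : B),
      ∃ e : (Bicategory.yoneda.obj a ⟶ P) ≌ P.obj (op a),
        e.functor = BicatYoneda.evalAtId P a ∧
        ∀ (z : P.obj (op a)) (b : B),
          ((e.inverse.obj z).app (op b)).toFunctor = BicatYoneda.actOn P z b) ∧
    BicatYoneda.IsLocalEquivalence (Bicategory.yoneda (B := B)) :=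
  ⟨fun P a => ⟨BicatYoneda.yonedaEquivalence P a, rfl, fun _ _ => rfl⟩,
    BicatYoneda.isLocalEquivalence_yoneda⟩
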